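/- Let $(X_t)_{t\ge 0}$ be a time homogeneous strong Markov process with càdlàg paths in a standard Borel space $\Omega$ (whose Borel structure comes from a given topology), and write $\mathbb P^x$ for its law when started at $x$. Let finitely many closed sets in $\Omega$, called milestones, be given, let $M$ be their union, and for each $x\in M$ let $M_x$ be a milestone containing $x$. Assume that, when started on $M$, $(X_t)$ a.s. does not visit the intersection of two different milestones at any time $t>0$. Let two of the milestones, $P$ (product) and $R$ (reactant), be disjoint, and let $\rho$ be a probability measure on $R$. For $x\in M$ put $\theta=\inf\{t>0: X_t\in N\text{ for some milestone }N\neq M_x\}$. The jump chain $(J_n)_{n\ge0}$ is the Markov chain on $M$ whose transition kernel $K$ is $$K(x,A)=\mathbb P^x(\theta<\infty,\ X_{\theta}\in A)\ \text{ for } x\in M\setminus P,\qquad K(x,A)=\rho(A)\ \text{ for } x\in P,$$ that is, the dynamics runs to the next milestone crossing, and upon reaching $P$ it restarts according to $\rho$; $K$ is assumed to be a Markov kernel. Write $\mathbb P^\xi,\mathbb E^\xi$ for the chain started from $J_0\sim\xi$, let $\sigma_P=\min\{n\ge 0: J_n\in P\}$, and assume that $\mathbb E^\xi[\sigma_P]<\infty$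 for every probability measure $\xi$ on $M$. Let $$\mu(C)=\frac{\mathbb E^\rho\big[\sum_{n=0}^{\sigma_P}\mathbf 1_{\{J_n\in C\}}\big]}{\mathbb E^\rho[\sigma_P+1]} .$$ Suppose that $M$ is compact, that $(J_n)$ is strong Feller (for every bounded measurable $f:M\to\mathbb R$ the function $x\mapsto\int_M f(y)\,K(x,dy)$ is continuous on $M$), and that $(J_n)$ is aperiodic in the sense that $$\gcd\{n\ge 1:\ \mathbb P^\rho(\sigma_P=n-1)>0\}=1 .$$ Then $(J_n)$ is geometrically ergodic: there are $\kappa\in(0,1)$ and a constant $c$ such that for all $n\ge 0$ $$\sup_{x\in M}\|\delta_xK^n-\mu\|_{TV}\le c\,\kappa^n,\qquad \|m_1-m_2\|_{TV}=\sup_{f\text{ measurable},\,|f|\le1}\Big|\int f\,dm_1-\int f\,dm_2\Big| .$$ -/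

import Mathlib

open MeasureTheory ProbabilityTheory Filter Topology
open scoped NNReal ENNReal

namespace Milestoning

/-- A time homogeneous strong Markov process `(X_t)` with càdlàg paths in `Ω`: a process `X` on a
sample space `W`, adapted to a filtration `ℱ`, with a law `Pr x` on `W` for every starting
point `x`. The strong Markov property is stated for one time increment `t` after an arbitrary
stopping time `τ`. -/
structure StrongMarkovProcess (Ω W : Type*) [TopologicalSpace Ω] [MeasurableSpace Ω]
    [mW : MeasurableSpace W] where
  X : ℝ≥0 → W → Ω
  ℱ : Filtration ℝ≥0 mW
  Pr : Kernel Ω W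
  isMarkovKernel : IsMarkovKernel Pr
  adapted : ∀ t, Measurable[ℱ t] (X t)
  right_continuous : ∀ w t, ContinuousWithinAt (fun s => X s w) (Set.Ici t) t
  left_limits : ∀ w t, ∃ l, Tendsto (fun s => X s w) (𝓝[<] t) (𝓝 l)
  start : ∀ x, ∀ᵐ w ∂(Pr x), X 0 w = x
  strong_markov : ∀ (x : Ω) (τ : W → WithTop ℝ≥0) (hτ : IsStoppingTime ℱ τ) (t : ℝ≥0)
    (A : Set Ω) (B : Set W), MeasurableSet A → MeasurableSet[hτ.measurableSpace] B →
      Pr x {w | w ∈ B ∧ τ w ≠ ⊤ ∧ X ((τ w).untopD 0 + t) w ∈ A} =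
        ∫⁻ w in {w | w ∈ B ∧ τ w ≠ ⊤}, Pr (X ((τ w).untopD 0) w) {w' | X t w' ∈ A} ∂(Pr x)

/-- The milestoning set-up: a process `(X_t)` (`toStrongMarkovProcess`), finitely many closed
milestones, two of which are the disjoint product set `P` and reactant set `R`, and a choice of
the milestone `M_x = cell x` of every point `x` of the union `M` of the milestones. Away from
its starting time the process does not visit the intersection of two milestones.

The restart of the dynamics upon reaching `P` is not part of `X`; it is built into the jump
chain (`jumpProb` below). Accordingly the behaviour of `X` after it has reached `P` plays no
role (it may, for instance, be stopped there). -/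
structure Dynamics (Ω W : Type*) [TopologicalSpace Ω] [MeasurableSpace Ω] [MeasurableSpace W]
    extends StrongMarkovProcess Ω W where
  milestones : Set (Set Ω)
  milestones_finite : milestones.Finite
  isClosed_of_mem : ∀ N ∈ milestones, IsClosed N
  P : Set Ω
  R : Set Ω
  P_mem : P ∈ milestones
  R_mem : R ∈ milestones
  disjoint_PR : Disjoint P R
  cell : Ω → Set Ω
  cell_mem : ∀ x ∈ ⋃₀ milestones, cell x ∈ milestones
  mem_cell : ∀ x ∈ ⋃₀ milestones, x ∈ cell x
  inter_null : ∀ x ∈ ⋃₀ milestones, ∀ N₁ ∈ milestones, ∀ N₂ ∈ milestones, N₁ ≠ N₂ →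
    Pr x {w | ∃ t, 0 < t ∧ X t w ∈ N₁ ∩ N₂} = 0

namespace Dynamics

variable {Ω W : Type*} [TopologicalSpace Ω] [MeasurableSpace Ω] [MeasurableSpace W]

/-- The set `M` of all points on milestones. -/
def M (D : Dynamics Ω W) : Set Ω := ⋃₀ D.milestones

/-- The product set `P`, as a subset of `M`. -/
def PM (D : Dynamics Ω W) : Set D.M := {x | (x : Ω) ∈ D.P}

/-- The reactant set `R`, as a subset of `M`. -/
def RM (D : Dynamics Ω W) : Set D.M := {x | (x : Ω) ∈ D.R}

/-- The positive times at which the path `w`, started at `x`, is on a milestone other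
than `M_x`. -/
def crossingTimes (D : Dynamics Ω W) (x : Ω) (w : W) : Set ℝ≥0 :=
  {t | 0 < t ∧ ∃ N ∈ D.milestones, N ≠ D.cell x ∧ D.X t w ∈ N}

/-- The event that the first milestone crossing after the start at `x` takes place (in finite
time) and that the crossing point lies in `A`. -/
def crossingEvent (D : Dynamics Ω W) (x : Ω) (A : Set D.M) : Set W :=
  {w | (D.crossingTimes x w).Nonempty ∧ D.X (sInf (D.crossingTimes x w)) w ∈ Subtype.val '' A}

open Classical in
/-- The probability that the jump chain, being at `x`, moves into `A`: off `P` the next point is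
the next milestone crossing point of `(X_t)` started at `x`; on `P` the dynamics restarts from
the distribution `ρ`. -/
noncomputable def jumpProb (D : Dynamics Ω W) (ρ : Measure D.M) (x : D.M) (A : Set D.M) : ℝ≥0∞ :=
  if x ∈ D.PM then ρ A else D.Pr x (D.crossingEvent x A)

/-- `K` is the transition kernel `K(x, dy)` of the jump chain. -/
def IsJumpKernel (D : Dynamics Ω W) (ρ : Measure D.M) (K : Kernel D.M D.M) : Prop :=
  ∀ (x : D.M) (A : Set D.M), MeasurableSet A → K x A = D.jumpProb ρ x A

end Dynamics

section Chain

variable {S : Type*} [MeasurableSpace S]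

/-- The law on `ℕ → S` of the Markov chain `(J_n)` with transition kernel `K` and
`J_0 ∼ ξ`. Here `J_n` is the `n`-th coordinate. -/
noncomputable def chainLaw (K : Kernel S S) [IsMarkovKernel K] (ξ : Measure S)
    [IsProbabilityMeasure ξ] : Measure (ℕ → S) :=
  Kernel.trajMeasure (X := fun _ => S) ξ
    (fun n => K.comap (fun h : (Π _ : Finset.Iic n, S) => h ⟨n, Finset.mem_Iic.2 le_rfl⟩)
      (measurable_pi_apply _))

/-- `σ_P = min {n ≥ 0 : J_n ∈ P}`, equal to `∞` if there is no such `n`. -/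
noncomputable def sigma (P : Set S) (J : ℕ → S) : ℕ∞ := ⨅ (n : ℕ) (_ : J n ∈ P), (n : ℕ∞)

/-- `E^ξ[σ_P]` -/
noncomputable def meanSigma (K : Kernel S S) [IsMarkovKernel K] (P : Set S) (ξ : Measure S)
    [IsProbabilityMeasure ξ] : ℝ≥0∞ :=
  ∫⁻ J, ((sigma P J : ℕ∞) : ℝ≥0∞) ∂(chainLaw K ξ)

/-- The unnormalized measure `ν(C) = E^ρ[∑_{n=0}^{σ_P} 1_{J_n ∈ C}]`, written as the sum over
`n` of the measures `C ↦ P^ρ(J_n ∈ C, n ≤ σ_P)`. -/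
noncomputable def flux (K : Kernel S S) [IsMarkovKernel K] (P : Set S) (ρ : Measure S)
    [IsProbabilityMeasure ρ] : Measure S :=
  Measure.sum fun n : ℕ => ((chainLaw K ρ).restrict {J | (n : ℕ∞) ≤ sigma P J}).map (fun J => J n)

/-- The distribution `μ = E^ρ[σ_P + 1]⁻¹ ν`. -/
noncomputable def stationary (K : Kernel S S) [IsMarkovKernel K] (P : Set S) (ρ : Measure S)
    [IsProbabilityMeasure ρ] : Measure S :=
  (∫⁻ J, (((sigma P J : ℕ∞) : ℝ≥0∞) + 1) ∂(chainLaw K ρ))⁻¹ • flux K P ρ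

/-- Aperiodicity: `gcd {n ≥ 1 : P^ρ(σ_P = n - 1) > 0} = 1`. -/
def Aperiodic (K : Kernel S S) [IsMarkovKernel K] (P : Set S) (ρ : Measure S)
    [IsProbabilityMeasure ρ] : Prop :=
  Nat.setGcd {n : ℕ | 1 ≤ n ∧ 0 < chainLaw K ρ {J | sigma P J = ((n - 1 : ℕ) : ℕ∞)}} = 1

/-- Strong Feller: `K f` is continuous for every bounded measurable `f`. -/
def StrongFeller [TopologicalSpace S] (K : Kernel S S) : Prop :=
  ∀ f : S → ℝ, Measurable f → (∃ c : ℝ, ∀ x, |f x| ≤ c) → Continuous fun x => ∫ y, f y ∂(K x)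

/-- The total variation distance
`‖m₁ - m₂‖_TV = sup {|m₁ f - m₂ f| : f measurable, |f| ≤ 1}`. -/
noncomputable def tvDist (m₁ m₂ : Measure S) : ℝ≥0∞ :=
  ⨆ (f : S → ℝ) (_ : Measurable f) (_ : ∀ x, |f x| ≤ 1),
    ENNReal.ofReal |∫ x, f x ∂m₁ - ∫ x, f x ∂m₂|

/-- The distribution `δ_x K^n = P^x(J_n ∈ ·)` of `J_n` when `J_0 = x`. -/
noncomputable def distAt (K : Kernel S S) [IsMarkovKernel K] (x : S) (n : ℕ) : Measure S :=
  (chainLaw K (Measure.dirac x)).map (fun J => J n)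

/-- Geometric ergodicity: `sup_x ‖δ_x K^n - μ‖_TV = O(κ^n)` for some `κ ∈ (0,1)`. -/
def GeometricallyErgodic (K : Kernel S S) [IsMarkovKernel K] (μ : Measure S) : Prop :=
  ∃ κ : ℝ, 0 < κ ∧ κ < 1 ∧ ∃ c : ℝ, ∀ n : ℕ,
    ⨆ x : S, tvDist (distAt K x n) μ ≤ ENNReal.ofReal (c * κ ^ n)

end Chain

end Milestoning

/-!
Of the way the jump chain arises from the underlying process, the proof uses only that it restarts
with the fixed law `ρ` from every point of `P`. Doeblin's minorization condition is derived from
these restarts, and the conclusion follows by contraction of oscillations.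

Since the mean hitting time is finite, the probability that the chain avoids `P` up to time `n`
decreases to `0` at every starting point. By the strong Feller property, one averaging step turns
these probabilities into continuous functions, so on the compact space `M` the decay is uniform by
Dini's theorem (`exists_survival_le_half`): for some `N`, the set `P` is reached before time `N` with
probability at least `1/2` from every point. Each visit to `P` regenerates `ρ` one step later.
Started from `ρ`, the times `n` at which `ρKⁿ` dominates a multiple of `ρ` form an additive monoid
containing all possible cycle lengths; aperiodicity puts all large integers into it
(`exists_smul_le_iterate_step`). Together these facts bound some power `Kᵐ(x, ·)` below by `ε ρ` with
`ε > 0` independent of `x` (`exists_minorization`). Hence `Kᵐ` contracts oscillations of bounded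
functions by the factor `1 - ε`, and the laws `δ_x Kⁿ` approach any invariant probability measure
geometrically fast (`exists_tvDist_iterate_step_le`).

The law of the chain killed on `P` is the iterated killed kernel (`map_restrict_le_sigma`), by the
Markov property of the path measure. It follows that the occupation measure of a cycle,
normalized by the mean cycle length, is an invariant probability measure (`step_stationary`).
-/

namespace Milestoning

section MeasureEvolution

variable {S : Type*} [MeasurableSpace S]

/-! ### Evolution of measures under a kernel -/

/-- One step `ν ↦ νK` of the evolution of measures under the kernel `K`. -/
noncomputable def step (K : Kernel S S) (ν : Measure S) : Measure S := ν.bind K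

/-- One step of the evolution of measures under `K` with killing on `P`: the mass sitting on `P`
is removed, the remaining mass moves according to `K`. -/
noncomputable def killedStep (K : Kernel S S) (P : Set S) (ν : Measure S) : Measure S :=
  step K (ν.restrict Pᶜ)

lemma step_apply (K : Kernel S S) (ν : Measure S) {A : Set S} (hA : MeasurableSet A) :
    step K ν A = ∫⁻ x, K x A ∂ν :=
  Measure.bind_apply hA K.measurable.aemeasurable

lemma step_mono (K : Kernel S S) : Monotone (step K) := fun ν₁ ν₂ h => by
  refine Measure.le_iff.2 fun A hA => ?_
  rw [step_apply K _ hA, step_apply K _ hA]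
  exact lintegral_mono' h le_rfl

lemma step_smul (K : Kernel S S) (c : ℝ≥0∞) (ν : Measure S) : step K (c • ν) = c • step K ν :=
  Measure.bind_smul c ν K

lemma step_add (K : Kernel S S) (ν₁ ν₂ : Measure S) :
    step K (ν₁ + ν₂) = step K ν₁ + step K ν₂ :=
  Measure.comp_add

lemma step_sum (K : Kernel S S) (ν : ℕ → Measure S) :
    step K (Measure.sum ν) = Measure.sum fun n => step K (ν n) :=
  Measure.bind_sum ν K K.measurable.aemeasurable

lemma step_univ (K : Kernel S S) [IsMarkovKernel K] (ν : Measure S) :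
    step K ν Set.univ = ν Set.univ := by
  simp [step_apply K ν MeasurableSet.univ]

instance (K : Kernel S S) [IsMarkovKernel K] (ν : Measure S) [IsProbabilityMeasure ν] :
    IsProbabilityMeasure (step K ν) :=
  ⟨by rw [step_univ, measure_univ]⟩

lemma isProbabilityMeasure_iterate_step (K : Kernel S S) [IsMarkovKernel K] (ν : Measure S)
    [IsProbabilityMeasure ν] (n : ℕ) : IsProbabilityMeasure ((step K)^[n] ν) := by
  induction n with
  | zero => simpa
  | succ n ih => rw [Function.iterate_succ_apply']; infer_instance

lemma iterate_step_mono (K : Kernel S S) (n : ℕ) : Monotone ((step K)^[n]) :=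
  (step_mono K).iterate n

lemma iterate_step_smul (K : Kernel S S) (c : ℝ≥0∞) (ν : Measure S) (n : ℕ) :
    (step K)^[n] (c • ν) = c • (step K)^[n] ν := by
  induction n with
  | zero => rfl
  | succ n ih => rw [Function.iterate_succ_apply', ih, step_smul, Function.iterate_succ_apply']

/-- One step splits into the killed evolution and a restart with law `ρ`. -/
lemma step_eq_killedStep_add {K : Kernel S S} {P : Set S} (hP : MeasurableSet P) {ρ : Measure S}
    (hK : ∀ x ∈ P, K x = ρ) (ν : Measure S) : step K ν = killedStep K P ν + ν P • ρ := by
  have h : step K (ν.restrict P) = ν P • ρ := by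
    refine Measure.ext fun A hA => ?_
    rw [step_apply K _ hA, setLIntegral_congr_fun hP (g := fun _ => ρ A)
      fun x hx => by simp [hK x hx]]
    simp [mul_comm]
  rw [killedStep, ← h, ← step_add, add_comm, Measure.restrict_add_restrict_compl hP]

/-- Mass on a set from which the kernel restarts with law `ρ` regenerates `ρ`. -/
lemma smul_le_step {K : Kernel S S} {P : Set S} (hP : MeasurableSet P) {ρ : Measure S}
    (hK : ∀ x ∈ P, K x = ρ) (ν : Measure S) : ν P • ρ ≤ step K ν := by
  rw [step_eq_killedStep_add hP hK]
  exact Measure.le_add_left le_rfl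

lemma iterate_killedStep_le (K : Kernel S S) (P : Set S) (ν : Measure S) (n : ℕ) :
    (killedStep K P)^[n] ν ≤ (step K)^[n] ν := by
  induction n with
  | zero => exact le_refl ν
  | succ n ih =>
    rw [Function.iterate_succ_apply', Function.iterate_succ_apply']
    exact step_mono K (Measure.restrict_le_self.trans ih)

lemma killedStep_univ_add {K : Kernel S S} [IsMarkovKernel K] {P : Set S} (hP : MeasurableSet P)
    (ν : Measure S) : killedStep K P ν Set.univ + ν P = ν Set.univ := by
  rw [killedStep, step_univ, Measure.restrict_apply_univ, add_comm, measure_add_measure_compl hP]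

lemma sum_iterate_killedStep_add {K : Kernel S S} [IsMarkovKernel K] {P : Set S}
    (hP : MeasurableSet P) (ν : Measure S) (n : ℕ) :
    ∑ k ∈ Finset.range n, (killedStep K P)^[k] ν P + (killedStep K P)^[n] ν Set.univ =
      ν Set.univ := by
  induction n with
  | zero => simp
  | succ n ih =>
    rw [Finset.sum_range_succ, Function.iterate_succ_apply', add_assoc,
      add_comm (_ : ℝ≥0∞) (killedStep K P _ Set.univ), killedStep_univ_add hP, ih]

/-- The probability that the chain started at a point does not visit `P` at the times
`0, …, n - 1`, by recursion on `n`. -/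
noncomputable def survival (K : Kernel S S) (P : Set S) : ℕ → S → ℝ≥0∞
  | 0 => 1
  | n + 1 => Pᶜ.indicator fun x => ∫⁻ y, survival K P n y ∂(K x)

lemma measurable_survival (K : Kernel S S) {P : Set S} (hP : MeasurableSet P) (n : ℕ) :
    Measurable (survival K P n) := by
  induction n with
  | zero => exact measurable_const
  | succ n ih => exact (ih.lintegral_kernel).indicator hP.compl

lemma lintegral_survival (K : Kernel S S) {P : Set S} (hP : MeasurableSet P) (n : ℕ)
    (ν : Measure S) : ∫⁻ x, survival K P n x ∂ν = (killedStep K P)^[n] ν Set.univ := by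
  induction n generalizing ν with
  | zero => simp [survival]
  | succ n ih =>
    rw [Function.iterate_succ_apply, ← ih, killedStep, step,
      Measure.lintegral_bind K.measurable.aemeasurable (measurable_survival K hP n).aemeasurable,
      survival, lintegral_indicator hP.compl]

lemma survival_le_one (K : Kernel S S) [IsMarkovKernel K] (P : Set S) (n : ℕ) (x : S) :
    survival K P n x ≤ 1 := by
  induction n generalizing x with
  | zero => simp [survival]
  | succ n ih =>
    refine (Set.indicator_le_self _ _ x).trans ?_
    calc ∫⁻ y, survival K P n y ∂(K x) ≤ ∫⁻ _, 1 ∂(K x) := lintegral_mono ih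
      _ = 1 := by simp

lemma antitone_iterate_killedStep_univ {K : Kernel S S} [IsMarkovKernel K] {P : Set S}
    (hP : MeasurableSet P) (ν : Measure S) :
    Antitone fun n => (killedStep K P)^[n] ν Set.univ :=
  antitone_nat_of_succ_le fun n => by
    rw [Function.iterate_succ_apply']
    exact le_self_add.trans_eq (killedStep_univ_add hP _)

/-- If the chain survives forever with probability zero from every starting law, then the strong
Feller property and compactness make the decay of the survival probabilities uniform in the
starting point (Dini's theorem). -/
lemma exists_survival_le_half [TopologicalSpace S] [CompactSpace S] {K : Kernel S S}
    [IsMarkovKernel K] {P : Set S} (hP : MeasurableSet P) (hSF : StrongFeller K)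
    (h0 : ∀ x, Tendsto (fun n => (killedStep K P)^[n] (K x) Set.univ) atTop (𝓝 0)) :
    ∃ n, ∀ x, survival K P n x ≤ 2⁻¹ := by
  have hlt (n : ℕ) (x : S) : ∫⁻ y, survival K P n y ∂(K x) ≠ ∞ := by
    refine ne_top_of_le_ne_top ENNReal.one_ne_top ?_
    calc ∫⁻ y, survival K P n y ∂(K x) ≤ ∫⁻ _, 1 ∂(K x) := lintegral_mono (survival_le_one K P n)
      _ = 1 := by simp
  let F : ℕ → S → ℝ := fun n x => (∫⁻ y, survival K P n y ∂(K x)).toReal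
  have hcont (n : ℕ) : Continuous (F n) := by
    have h := hSF (fun y => (survival K P n y).toReal) (measurable_survival K hP n).ennreal_toReal
      ⟨1, fun y => by
        rw [abs_of_nonneg ENNReal.toReal_nonneg]
        exact ENNReal.toReal_mono ENNReal.one_ne_top (survival_le_one K P n y)⟩
    refine h.congr fun x => ?_
    exact integral_toReal (measurable_survival K hP n).aemeasurable
      (ae_of_all _ fun y => (survival_le_one K P n y).trans_lt ENNReal.one_lt_top)
  have hanti : Antitone F := fun m n hmn x => by
    refine ENNReal.toReal_mono (hlt m x) ?_
    rw [lintegral_survival K hP, lintegral_survival K hP]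
    exact antitone_iterate_killedStep_univ hP _ hmn
  have hlim (x : S) : Tendsto (F · x) atTop (𝓝 ((fun _ : S => (0 : ℝ)) x)) := by
    have h := (ENNReal.tendsto_toReal ENNReal.zero_ne_top).comp (h0 x)
    simpa only [F, lintegral_survival K hP, Function.comp_def, ENNReal.toReal_zero] using h
  have hunif := hanti.tendstoUniformly_of_forall_tendsto hcont continuous_const hlim
  obtain ⟨n, hn⟩ := (Metric.tendstoUniformly_iff.1 hunif 2⁻¹ (by norm_num)).exists
  refine ⟨n + 1, fun x => (Set.indicator_le_self _ _ x).trans ?_⟩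
  have h := hn x
  rw [dist_zero_left, Real.norm_of_nonneg ENNReal.toReal_nonneg] at h
  rw [← ENNReal.ofReal_toReal (hlt n x)]
  calc ENNReal.ofReal (F n x) ≤ ENNReal.ofReal 2⁻¹ := ENNReal.ofReal_le_ofReal h.le
    _ = 2⁻¹ := by rw [ENNReal.ofReal_inv_of_pos two_pos]; simp

/-! ### Regeneration and minorization -/

/-- If the lengths of the cycles from `ρ` through `P` back to `ρ` have greatest common divisor `1`,
then the chain started from `ρ` keeps a multiple of `ρ` at all large times: the times at which it
does so form an additive submonoid of `ℕ`. -/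
lemma exists_smul_le_iterate_step {K : Kernel S S} {P : Set S} (hP : MeasurableSet P)
    {ρ : Measure S} (hK : ∀ x ∈ P, K x = ρ)
    (hgcd : Nat.setGcd {n : ℕ | 1 ≤ n ∧ 0 < (killedStep K P)^[n - 1] ρ P} = 1) :
    ∃ n₀, ∀ n ≥ n₀, ∃ c : ℝ≥0∞, c ≠ 0 ∧ c • ρ ≤ (step K)^[n] ρ := by
  let G : AddSubmonoid ℕ :=
    { carrier := {n | ∃ c : ℝ≥0∞, c ≠ 0 ∧ c • ρ ≤ (step K)^[n] ρ}
      zero_mem' := ⟨1, one_ne_zero, by simp⟩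
      add_mem' := by
        rintro a b ⟨c, hc, hca⟩ ⟨d, hd, hdb⟩
        refine ⟨d * c, mul_ne_zero hd hc, ?_⟩
        rw [Function.iterate_add_apply]
        calc (d * c) • ρ = d • c • ρ := mul_smul d c ρ
          _ ≤ d • (step K)^[a] ρ := by gcongr
          _ = (step K)^[a] (d • ρ) := (iterate_step_smul K d ρ a).symm
          _ ≤ _ := iterate_step_mono K a hdb }
  have hsub : {n : ℕ | 1 ≤ n ∧ 0 < (killedStep K P)^[n - 1] ρ P} ⊆ G := by
    rintro n ⟨hn, hpos⟩
    obtain ⟨k, rfl⟩ := Nat.exists_eq_add_of_le' hn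
    rw [Nat.add_sub_cancel] at hpos
    refine ⟨(step K)^[k] ρ P, (hpos.trans_le (iterate_killedStep_le K P ρ k P)).ne', ?_⟩
    rw [Function.iterate_succ_apply']
    exact smul_le_step hP hK _
  obtain ⟨n₀, h⟩ := Nat.exists_mem_closure_of_ge
    {n : ℕ | 1 ≤ n ∧ 0 < (killedStep K P)^[n - 1] ρ P}
  refine ⟨n₀, fun n hn => ?_⟩
  exact (AddSubmonoid.closure_le.2 hsub) (h n hn (by rw [hgcd]; exact one_dvd n))

lemma exists_forall_lt_smul_le {ρ : Measure S} {ν : ℕ → Measure S}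
    (h : ∀ n, ∃ c : ℝ≥0∞, c ≠ 0 ∧ c • ρ ≤ ν n) (N : ℕ) :
    ∃ c : ℝ≥0∞, c ≠ 0 ∧ ∀ n < N, c • ρ ≤ ν n := by
  induction N with
  | zero => exact ⟨1, one_ne_zero, by simp⟩
  | succ N ih =>
    obtain ⟨c, hc, hcN⟩ := ih
    obtain ⟨d, hd, hdN⟩ := h N
    refine ⟨min c d, (lt_min hc.bot_lt hd.bot_lt).ne', fun n hn => ?_⟩
    rcases Nat.lt_succ_iff_lt_or_eq.1 hn with hn | rfl
    · exact le_trans (by gcongr; exact min_le_left c d) (hcN n hn)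
    · exact le_trans (by gcongr; exact min_le_right c d) hdN

/-- Doeblin's condition: if `P` is reached before time `N` with probability at least `1/2` from
every point and the chain started from `ρ` keeps a multiple of `ρ` at all large times, then some
power of the kernel dominates a multiple of `ρ`. -/
lemma exists_minorization {K : Kernel S S} [IsMarkovKernel K] {P : Set S} (hP : MeasurableSet P)
    {ρ : Measure S} [IsProbabilityMeasure ρ] (hK : ∀ x ∈ P, K x = ρ) {N : ℕ}
    (hN : ∀ x, survival K P N x ≤ 2⁻¹) {n₀ : ℕ}
    (hn₀ : ∀ n ≥ n₀, ∃ c : ℝ≥0∞, c ≠ 0 ∧ c • ρ ≤ (step K)^[n] ρ) :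
    ∃ m, 0 < m ∧ ∃ ε : ℝ, 0 < ε ∧ ε < 1 ∧
      ∀ x, ENNReal.ofReal ε • ρ ≤ (step K)^[m] (Measure.dirac x) := by
  obtain ⟨c, hc, hcN⟩ := exists_forall_lt_smul_le (ν := fun j => (step K)^[n₀ + j] ρ)
    (fun j => hn₀ _ (Nat.le_add_right _ _)) N
  -- A visit to `P` at time `k < N` regenerates `ρ` at time `k + 1`, leaving `n₀ + (N - 1 - k)` steps.
  have hvisit (x : S) (k : ℕ) (hk : k < N) :
      ((killedStep K P)^[k] (Measure.dirac x) P * c) • ρ ≤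
        (step K)^[n₀ + N] (Measure.dirac x) := by
    have hsplit : n₀ + N = (n₀ + (N - 1 - k)) + (k + 1) := by omega
    rw [hsplit, Function.iterate_add_apply, Function.iterate_succ_apply']
    calc ((killedStep K P)^[k] (Measure.dirac x) P * c) • ρ
        = (killedStep K P)^[k] (Measure.dirac x) P • c • ρ := mul_smul _ _ _
      _ ≤ (step K)^[k] (Measure.dirac x) P • (step K)^[n₀ + (N - 1 - k)] ρ := by
        gcongr
        · exact iterate_killedStep_le K P _ k
        · exact hcN _ (by omega)
      _ = (step K)^[n₀ + (N - 1 - k)] ((step K)^[k] (Measure.dirac x) P • ρ) :=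
        (iterate_step_smul K _ ρ _).symm
      _ ≤ _ := iterate_step_mono K _ (smul_le_step hP hK _)
  have hhit (x : S) :
      2⁻¹ ≤ ∑ k ∈ Finset.range N, (killedStep K P)^[k] (Measure.dirac x) P := by
    have h := sum_iterate_killedStep_add (K := K) hP (Measure.dirac x) N
    rw [← lintegral_survival K hP, lintegral_dirac' _ (measurable_survival K hP N),
      measure_univ, ← ENNReal.inv_two_add_inv_two] at h
    by_contra! hlt
    exact (ENNReal.add_lt_add_of_lt_of_le (ne_top_of_le_ne_top (by simp) (hN x))
      hlt (hN x)).ne h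
  have hbound (x : S) : (2⁻¹ * c / N) • ρ ≤ (step K)^[n₀ + N] (Measure.dirac x) := by
    have : IsProbabilityMeasure ((step K)^[n₀ + N] (Measure.dirac x)) :=
      isProbabilityMeasure_iterate_step K _ _
    refine Measure.le_iff.2 fun A hA => ?_
    have hsum : 2⁻¹ * c * ρ A ≤ N * (step K)^[n₀ + N] (Measure.dirac x) A :=
      calc 2⁻¹ * c * ρ A
          ≤ (∑ k ∈ Finset.range N, (killedStep K P)^[k] (Measure.dirac x) P) * c * ρ A := by
            gcongr; exact hhit x
        _ = ∑ k ∈ Finset.range N, (((killedStep K P)^[k] (Measure.dirac x) P * c) • ρ) A := by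
            simp [Finset.sum_mul]
        _ ≤ ∑ k ∈ Finset.range N, (step K)^[n₀ + N] (Measure.dirac x) A :=
            Finset.sum_le_sum fun k hk => hvisit x k (Finset.mem_range.1 hk) A
        _ = _ := by simp
    rw [Measure.smul_apply, smul_eq_mul, ENNReal.mul_comm_div, ← mul_div_assoc]
    exact ENNReal.div_le_of_le_mul' hsum
  have hne : Nonempty S := ρ.nonempty_of_neZero
  have hNpos : 0 < N := by
    obtain ⟨x⟩ := hne
    refine Nat.pos_of_ne_zero fun h0 => ?_
    have h := hN x
    rw [h0, survival, Pi.one_apply] at h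
    exact h.not_gt ENNReal.one_half_lt_one
  have hone : 2⁻¹ * c / N ≤ 1 := by
    obtain ⟨x⟩ := hne
    have : IsProbabilityMeasure ((step K)^[n₀ + N] (Measure.dirac x)) :=
      isProbabilityMeasure_iterate_step K _ _
    simpa using hbound x Set.univ
  have hpos : 2⁻¹ * c / N ≠ 0 :=
    ENNReal.div_ne_zero.2 ⟨mul_ne_zero (by simp) hc, ENNReal.natCast_ne_top N⟩
  have htop : 2⁻¹ * c / N ≠ ∞ := ne_top_of_le_ne_top ENNReal.one_ne_top hone
  have hreal : 0 < (2⁻¹ * c / N).toReal := ENNReal.toReal_pos hpos htop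
  have hreal1 : (2⁻¹ * c / N).toReal ≤ 1 := ENNReal.toReal_mono ENNReal.one_ne_top hone
  refine ⟨n₀ + N, by omega, (2⁻¹ * c / N).toReal / 2, by linarith, by linarith, fun x => ?_⟩
  refine le_trans ?_ (hbound x)
  gcongr
  calc ENNReal.ofReal ((2⁻¹ * c / N).toReal / 2) ≤ ENNReal.ofReal (2⁻¹ * c / N).toReal :=
        ENNReal.ofReal_le_ofReal (by linarith)
    _ = _ := ENNReal.ofReal_toReal htop

end MeasureEvolution

section Contraction

variable {S : Type*} [MeasurableSpace S]

/-! ### Contraction of oscillations -/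

/-- The action `f ↦ Kf` of the kernel `K` on functions. -/
noncomputable def average (K : Kernel S S) (f : S → ℝ) (x : S) : ℝ := ∫ y, f y ∂(K x)

lemma measurable_average (K : Kernel S S) [IsMarkovKernel K] {f : S → ℝ} (hf : Measurable f) :
    Measurable (average K f) :=
  hf.stronglyMeasurable.integral_kernel.measurable

lemma abs_integral_le_of_abs_le (ν : Measure S) [IsProbabilityMeasure ν] {f : S → ℝ} {C : ℝ}
    (hC : ∀ x, |f x| ≤ C) : |∫ x, f x ∂ν| ≤ C := by
  have h := norm_integral_le_of_norm_le_const (μ := ν) (f := f) (ae_of_all _ hC)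
  rwa [probReal_univ, mul_one] at h

lemma integrable_of_abs_le (ν : Measure S) [IsFiniteMeasure ν] {f : S → ℝ} (hf : Measurable f)
    {C : ℝ} (hC : ∀ x, |f x| ≤ C) : Integrable f ν :=
  .of_bound hf.aestronglyMeasurable C (ae_of_all _ hC)

lemma integral_step (K : Kernel S S) [IsMarkovKernel K] (ν : Measure S) [IsProbabilityMeasure ν]
    {f : S → ℝ} (hf : Measurable f) {C : ℝ} (hC : ∀ x, |f x| ≤ C) :
    ∫ x, f x ∂(step K ν) = ∫ x, average K f x ∂ν := by
  have h := integrable_of_abs_le (step K ν) hf hC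
  rw [step, Measure.comp_eq_comp_const_apply] at h ⊢
  rw [Kernel.integral_comp h, Kernel.const_apply]
  rfl

lemma measurable_iterate_average (K : Kernel S S) [IsMarkovKernel K] {f : S → ℝ}
    (hf : Measurable f) (n : ℕ) : Measurable ((average K)^[n] f) := by
  induction n with
  | zero => exact hf
  | succ n ih => rw [Function.iterate_succ_apply']; exact measurable_average K ih

lemma abs_iterate_average_le (K : Kernel S S) [IsMarkovKernel K] {f : S → ℝ} {C : ℝ}
    (hC : ∀ x, |f x| ≤ C) (n : ℕ) (x : S) : |(average K)^[n] f x| ≤ C := by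
  induction n generalizing x with
  | zero => exact hC x
  | succ n ih => rw [Function.iterate_succ_apply']; exact abs_integral_le_of_abs_le (K x) ih

lemma integral_iterate_step (K : Kernel S S) [IsMarkovKernel K] (ν : Measure S)
    [IsProbabilityMeasure ν] {f : S → ℝ} (hf : Measurable f) {C : ℝ} (hC : ∀ x, |f x| ≤ C)
    (n : ℕ) : ∫ x, f x ∂((step K)^[n] ν) = ∫ x, (average K)^[n] f x ∂ν := by
  induction n generalizing f with
  | zero => rfl
  | succ n ih =>
    have := isProbabilityMeasure_iterate_step K ν n
    rw [Function.iterate_succ_apply', integral_step K _ hf hC, ih (measurable_average K hf)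
      (abs_iterate_average_le K hC 1), Function.iterate_succ_apply]

lemma integral_iterate_step_dirac (K : Kernel S S) [IsMarkovKernel K] {f : S → ℝ}
    (hf : Measurable f) {C : ℝ} (hC : ∀ x, |f x| ≤ C) (n : ℕ) (x : S) :
    ∫ y, f y ∂((step K)^[n] (Measure.dirac x)) = (average K)^[n] f x := by
  rw [integral_iterate_step K _ hf hC,
    integral_dirac' _ _ (measurable_iterate_average K hf n).stronglyMeasurable]

/-- Two probability measures with a common part `ε ρ` integrate a function of oscillation at most
`c` to values at distance at most `(1 - ε) c`. -/
lemma integral_sub_integral_le {ρ ν₁ ν₂ : Measure S} [IsProbabilityMeasure ρ]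
    [IsProbabilityMeasure ν₁] [IsProbabilityMeasure ν₂] {ε : ℝ} (hε : 0 ≤ ε)
    (h₁ : ENNReal.ofReal ε • ρ ≤ ν₁) (h₂ : ENNReal.ofReal ε • ρ ≤ ν₂) {f : S → ℝ}
    (hf : Measurable f) {C c : ℝ} (hC : ∀ x, |f x| ≤ C) (hc : ∀ x y, f x - f y ≤ c) :
    ∫ x, f x ∂ν₁ - ∫ x, f x ∂ν₂ ≤ (1 - ε) * c := by
  have : Nonempty S := ρ.nonempty_of_neZero
  have : IsFiniteMeasure (ENNReal.ofReal ε • ρ) := ρ.smul_finite ENNReal.ofReal_ne_top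
  have hdecomp (ν : Measure S) [IsProbabilityMeasure ν] (h : ENNReal.ofReal ε • ρ ≤ ν) :
      ∃ η : Measure S, IsFiniteMeasure η ∧ η.real Set.univ = 1 - ε ∧
        ∫ x, f x ∂ν = ∫ x, f x ∂η + ε * ∫ x, f x ∂ρ := by
    have heq : ν - ENNReal.ofReal ε • ρ + ENNReal.ofReal ε • ρ = ν :=
      Measure.sub_add_cancel_of_le h
    have : IsFiniteMeasure (ν - ENNReal.ofReal ε • ρ) := isFiniteMeasure_of_le ν Measure.sub_le
    refine ⟨ν - ENNReal.ofReal ε • ρ, this, ?_, ?_⟩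
    · have h1 : (ν - ENNReal.ofReal ε • ρ + ENNReal.ofReal ε • ρ).real Set.univ = 1 := by
        rw [heq, probReal_univ]
      rw [measureReal_add_apply, measureReal_ennreal_smul_apply, probReal_univ (μ := ρ),
        ENNReal.toReal_ofReal hε, mul_one] at h1
      linarith
    · conv_lhs => rw [← heq]
      rw [integral_add_measure (integrable_of_abs_le _ hf hC) (integrable_of_abs_le _ hf hC),
        integral_smul_measure, ENNReal.toReal_ofReal hε, smul_eq_mul]
  obtain ⟨η₁, hfin₁, hmass₁, hint₁⟩ := hdecomp ν₁ h₁
  obtain ⟨η₂, hfin₂, hmass₂, hint₂⟩ := hdecomp ν₂ h₂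
  have hbdd : BddAbove (Set.range f) := ⟨C, by rintro _ ⟨x, rfl⟩; exact (abs_le.1 (hC x)).2⟩
  have hup : ∫ x, f x ∂η₁ ≤ (1 - ε) * ⨆ x, f x := by
    calc ∫ x, f x ∂η₁ ≤ ∫ _, (⨆ x, f x) ∂η₁ :=
          integral_mono (integrable_of_abs_le _ hf hC) (integrable_const _) fun x =>
            le_ciSup hbdd x
      _ = _ := by rw [integral_const, hmass₁, smul_eq_mul]
  have hlow : (1 - ε) * ((⨆ x, f x) - c) ≤ ∫ x, f x ∂η₂ := by
    calc (1 - ε) * ((⨆ x, f x) - c) = ∫ _, ((⨆ x, f x) - c) ∂η₂ := by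
          rw [integral_const, hmass₂, smul_eq_mul]
      _ ≤ ∫ x, f x ∂η₂ :=
          integral_mono (integrable_const _) (integrable_of_abs_le _ hf hC) fun y => by
            have : ⨆ x, f x ≤ f y + c := ciSup_le fun x => by linarith [hc x y]
            show (⨆ x, f x) - c ≤ f y
            linarith
  rw [hint₁, hint₂]
  linarith

/-- Under Doeblin's condition for the `m`-th power of `K`, every `m` steps contract the oscillation
by the factor `1 - ε`. -/
lemma iterate_average_sub_le {K : Kernel S S} [IsMarkovKernel K] {ρ : Measure S}
    [IsProbabilityMeasure ρ] {m : ℕ} {ε : ℝ} (hε : 0 ≤ ε)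
    (hm : ∀ x, ENNReal.ofReal ε • ρ ≤ (step K)^[m] (Measure.dirac x)) {f : S → ℝ}
    (hf : Measurable f) {C : ℝ} (hC : ∀ x, |f x| ≤ C) (q : ℕ) (x y : S) :
    (average K)^[m * q] f x - (average K)^[m * q] f y ≤ (1 - ε) ^ q * (2 * C) := by
  induction q generalizing x y with
  | zero =>
    have hx := (abs_le.1 (hC x)).2
    have hy := (abs_le.1 (hC y)).1
    simp only [mul_zero, Function.iterate_zero, id_eq, pow_zero, one_mul]
    linarith
  | succ q ih =>
    have hmeas := measurable_iterate_average K hf (m * q)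
    have hbd := abs_iterate_average_le K hC (m * q)
    have := isProbabilityMeasure_iterate_step K (Measure.dirac x) m
    have := isProbabilityMeasure_iterate_step K (Measure.dirac y) m
    rw [Nat.mul_succ, Nat.add_comm, Function.iterate_add_apply,
      ← integral_iterate_step_dirac K hmeas hbd, ← integral_iterate_step_dirac K hmeas hbd,
      pow_succ', mul_assoc]
    exact integral_sub_integral_le hε (hm x) (hm y) hmeas hbd ih

/-- Doeblin's theorem: under the minorization condition the laws `δ_x Kⁿ` converge to an invariant
probability measure in total variation, uniformly in `x` and geometrically fast. -/
lemma exists_tvDist_iterate_step_le {K : Kernel S S} [IsMarkovKernel K] {ρ : Measure S}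
    [IsProbabilityMeasure ρ] {m : ℕ} (hm0 : 0 < m) {ε : ℝ} (hε : 0 < ε) (hε1 : ε < 1)
    (hm : ∀ x, ENNReal.ofReal ε • ρ ≤ (step K)^[m] (Measure.dirac x)) {μ : Measure S}
    [IsProbabilityMeasure μ] (hμ : step K μ = μ) :
    ∃ κ : ℝ, 0 < κ ∧ κ < 1 ∧ ∃ c : ℝ, ∀ n : ℕ, ∀ x,
      tvDist ((step K)^[n] (Measure.dirac x)) μ ≤ ENNReal.ofReal (c * κ ^ n) := by
  have hpos : 0 < 1 - ε := by linarith
  obtain ⟨κ, hκ0, hκ1, hκ⟩ : ∃ κ : ℝ, 0 < κ ∧ κ < 1 ∧ κ ^ m = 1 - ε :=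
    ⟨(1 - ε) ^ (m⁻¹ : ℝ), Real.rpow_pos_of_pos hpos _,
      Real.rpow_lt_one hpos.le (by linarith) (by positivity),
      Real.rpow_inv_natCast_pow hpos.le hm0.ne'⟩
  refine ⟨κ, hκ0, hκ1, 2 / κ ^ m, fun n x => ?_⟩
  refine iSup_le fun f => iSup_le fun hf => iSup_le fun hf1 => ENNReal.ofReal_le_ofReal ?_
  have hosc (x y : S) :
      (average K)^[n] f x - (average K)^[n] f y ≤ 2 / κ ^ m * κ ^ n := by
    have h := iterate_average_sub_le hε.le hm (measurable_iterate_average K hf (n % m))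
      (abs_iterate_average_le K hf1 (n % m)) (n / m) x y
    rw [← Function.iterate_add_apply, Nat.div_add_mod, ← hκ, ← pow_mul] at h
    refine h.trans ?_
    have hn : n ≤ m * (n / m) + m := by
      have := Nat.div_add_mod n m
      have := Nat.mod_lt n hm0
      omega
    have hpow := pow_le_pow_of_le_one hκ0.le hκ1.le hn
    rw [pow_add] at hpow
    rw [div_mul_eq_mul_div, le_div_iff₀ (by positivity)]
    linarith
  have hmeas := measurable_iterate_average K hf n
  have hbd := abs_iterate_average_le K hf1 n
  have hinv : ∫ y, f y ∂μ = ∫ y, (average K)^[n] f y ∂μ := by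
    rw [← integral_iterate_step K μ hf hf1, Function.iterate_fixed hμ]
  have hconst : (average K)^[n] f x = ∫ _, (average K)^[n] f x ∂μ := by simp
  rw [integral_iterate_step_dirac K hf hf1, hinv, hconst,
    ← integral_sub (integrable_const _) (integrable_of_abs_le μ hmeas hbd)]
  exact abs_integral_le_of_abs_le μ fun y => abs_sub_le_iff.2 ⟨hosc x y, hosc y x⟩

end Contraction

section PathSpace

/-! ### The hitting time on path space -/

variable {S : Type*}

lemma le_sigma_iff {P : Set S} {J : ℕ → S} {n : ℕ} :
    (n : ℕ∞) ≤ sigma P J ↔ ∀ k < n, J k ∉ P := by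
  simp only [sigma, le_iInf_iff, Nat.cast_le]
  exact ⟨fun h k hk hJ => (h k hJ).not_gt hk, fun h k hJ => not_lt.1 fun hk => h k hk hJ⟩

lemma sigma_eq_iff {P : Set S} {J : ℕ → S} {n : ℕ} :
    sigma P J = n ↔ (n : ℕ∞) ≤ sigma P J ∧ J n ∈ P := by
  constructor
  · intro h
    refine ⟨h.ge, ?_⟩
    by_contra hJ
    have hle : ((n + 1 : ℕ) : ℕ∞) ≤ sigma P J := le_sigma_iff.2 fun k hk => by
      rcases Nat.lt_succ_iff_lt_or_eq.1 hk with hk | rfl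
      · exact le_sigma_iff.1 h.ge k hk
      · exact hJ
    rw [h, Nat.cast_le] at hle
    omega
  · rintro ⟨h, hJ⟩
    exact le_antisymm (iInf₂_le n hJ) h

lemma setOf_succ_le_sigma (P : Set S) (n : ℕ) :
    {J : ℕ → S | ((n + 1 : ℕ) : ℕ∞) ≤ sigma P J} =
      {J | (n : ℕ∞) ≤ sigma P J} ∩ (fun J => J n) ⁻¹' Pᶜ := by
  ext J
  simp only [Set.mem_ofPred_eq, Set.mem_inter_iff, le_sigma_iff, Set.mem_preimage,
    Set.mem_compl_iff]
  exact Nat.forall_lt_succ_right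

variable [MeasurableSpace S]

lemma measurableSet_le_sigma {P : Set S} (hP : MeasurableSet P) (n : ℕ) :
    MeasurableSet {J : ℕ → S | (n : ℕ∞) ≤ sigma P J} := by
  induction n with
  | zero => simp
  | succ n ih =>
    rw [setOf_succ_le_sigma]
    exact ih.inter (measurable_pi_apply n hP.compl)

lemma natCast_tsum_indicator (a : ℕ∞) :
    ∑' n : ℕ, {m : ℕ | (m : ℕ∞) ≤ a}.indicator (fun _ => (1 : ℝ≥0∞)) n = (a : ℝ≥0∞) + 1 := by
  induction a using ENat.recTopCoe with
  | top => simp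
  | coe a =>
    rw [tsum_eq_sum (s := Finset.range (a + 1))]
    · rw [Finset.sum_congr rfl fun n hn => Set.indicator_of_mem (s := {m : ℕ | (m : ℕ∞) ≤ a}) (by
        simpa [Nat.lt_succ_iff] using hn) _]
      simp
    · intro n hn
      refine Set.indicator_of_notMem ?_ _
      simpa [Nat.lt_succ_iff] using hn

/-! ### The law of the chain -/

variable (K : Kernel S S) [IsMarkovKernel K] (ξ : Measure S) [IsProbabilityMeasure ξ]

instance : IsProbabilityMeasure (chainLaw K ξ) := by
  unfold chainLaw; infer_instance

lemma map_zero_chainLaw : (chainLaw K ξ).map (fun J => J 0) = ξ := by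
  have h0 : (fun J : ℕ → S => J 0) = (fun h : (Π _ : Finset.Iic 0, S) =>
      h ⟨0, Finset.mem_Iic.2 le_rfl⟩) ∘ Preorder.frestrictLe 0 := rfl
  have hev : Measurable fun h : (Π _ : Finset.Iic 0, S) => h ⟨0, Finset.mem_Iic.2 le_rfl⟩ :=
    measurable_pi_apply _
  rw [h0, ← Measure.map_map hev (Preorder.measurable_frestrictLe 0), chainLaw,
    Kernel.trajMeasure, Measure.map_comp _ _ (Preorder.measurable_frestrictLe 0),
    Kernel.traj_map_frestrictLe, Kernel.partialTraj_self, Measure.id_comp,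
    Measure.map_map hev (MeasurableEquiv.measurable _)]
  exact Measure.map_id

/-- Markov property: on an event depending on the first `n + 1` coordinates, the law of the next
coordinate arises from that of the current one by one step of the kernel. -/
lemma map_succ_restrict_chainLaw (n : ℕ) {B : Set (Π _ : Finset.Iic n, S)} (hB : MeasurableSet B) :
    ((chainLaw K ξ).restrict (Preorder.frestrictLe n ⁻¹' B)).map (fun J => J (n + 1)) =
      step K (((chainLaw K ξ).restrict (Preorder.frestrictLe n ⁻¹' B)).map fun J => J n) := by
  have hr : Measurable (Preorder.frestrictLe (π := fun _ : ℕ => S) n) :=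
    Preorder.measurable_frestrictLe n
  have hpre := hr hB
  refine Measure.ext fun A hA => ?_
  have h := congrArg (fun m => m (B ×ˢ A))
    (Kernel.map_frestrictLe_trajMeasure_compProd_eq_map_trajMeasure (X := fun _ => S) (μ₀ := ξ)
      (κ := fun n => K.comap (fun h : (Π _ : Finset.Iic n, S) => h ⟨n, Finset.mem_Iic.2 le_rfl⟩)
        (measurable_pi_apply _)) (a := n))
  rw [← chainLaw, Measure.compProd_apply_prod hB hA,
    Measure.map_apply (hr.prodMk (measurable_pi_apply _)) (hB.prod hA),
    setLIntegral_map hB (Kernel.measurable_coe _ hA) hr] at h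
  rw [step_apply K _ hA, lintegral_map (K.measurable_coe hA) (measurable_pi_apply n),
    Measure.map_apply (measurable_pi_apply _) hA, Measure.restrict_apply (measurable_pi_apply _ hA)]
  exact (h.trans (congrArg _ (Set.inter_comm _ _))).symm

lemma distAt_eq (x : S) (n : ℕ) : distAt K x n = (step K)^[n] (Measure.dirac x) := by
  rw [distAt]
  induction n with
  | zero => exact map_zero_chainLaw K _
  | succ n ih =>
    have h := map_succ_restrict_chainLaw K (Measure.dirac x) n MeasurableSet.univ
    rw [Set.preimage_univ, Measure.restrict_univ] at h
    rw [h, ih, Function.iterate_succ_apply']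

/-- The law of the chain before and upon the first visit to `P` is the killed evolution. -/
lemma map_restrict_le_sigma {P : Set S} (hP : MeasurableSet P) (n : ℕ) :
    ((chainLaw K ξ).restrict {J | (n : ℕ∞) ≤ sigma P J}).map (fun J => J n) =
      (killedStep K P)^[n] ξ := by
  induction n with
  | zero => simpa using map_zero_chainLaw K ξ
  | succ n ih =>
    have hB : MeasurableSet {h : (Π _ : Finset.Iic n, S) | ∀ k, h k ∉ P} := by
      rw [Set.ofPred_forall]
      refine .iInter fun k => ?_
      have hk : Measurable fun h : (Π _ : Finset.Iic n, S) => h k := measurable_pi_apply k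
      exact hk hP.compl
    have hpre : {J : ℕ → S | ((n + 1 : ℕ) : ℕ∞) ≤ sigma P J} =
        Preorder.frestrictLe n ⁻¹' {h : (Π _ : Finset.Iic n, S) | ∀ k, h k ∉ P} := by
      ext J
      simp only [Set.mem_ofPred_eq, le_sigma_iff, Set.mem_preimage, Subtype.forall,
        Finset.mem_Iic, Nat.lt_succ_iff]
      rfl
    rw [hpre, map_succ_restrict_chainLaw K ξ n hB, ← hpre, setOf_succ_le_sigma, Set.inter_comm,
      ← Measure.restrict_restrict (measurable_pi_apply n hP.compl),
      ← Measure.restrict_map (measurable_pi_apply n) hP.compl, ih, Function.iterate_succ_apply']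
    rfl

lemma chainLaw_sigma_eq {P : Set S} (hP : MeasurableSet P) (n : ℕ) :
    chainLaw K ξ {J | sigma P J = n} = (killedStep K P)^[n] ξ P := by
  rw [← map_restrict_le_sigma K ξ hP, Measure.map_apply (measurable_pi_apply n) hP,
    Measure.restrict_apply (measurable_pi_apply n hP)]
  congr 1
  ext J
  simp [sigma_eq_iff, and_comm]

lemma flux_eq {P : Set S} (hP : MeasurableSet P) :
    flux K P ξ = Measure.sum fun n => (killedStep K P)^[n] ξ :=
  congrArg Measure.sum (funext fun n => map_restrict_le_sigma K ξ hP n)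

/-- The expected cycle length `E^ξ[σ_P + 1]` is the total mass of the killed evolution. -/
lemma lintegral_sigma_add_one {P : Set S} (hP : MeasurableSet P) :
    ∫⁻ J, (((sigma P J : ℕ∞) : ℝ≥0∞) + 1) ∂(chainLaw K ξ) =
      ∑' n, (killedStep K P)^[n] ξ Set.univ := by
  calc ∫⁻ J, (((sigma P J : ℕ∞) : ℝ≥0∞) + 1) ∂(chainLaw K ξ)
      = ∫⁻ J, ∑' n : ℕ, {J : ℕ → S | (n : ℕ∞) ≤ sigma P J}.indicator (fun _ => 1) J
          ∂(chainLaw K ξ) :=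
        lintegral_congr fun J => (natCast_tsum_indicator (sigma P J)).symm
    _ = ∑' n : ℕ, chainLaw K ξ {J | (n : ℕ∞) ≤ sigma P J} := by
        rw [lintegral_tsum fun n =>
          (measurable_const.indicator (measurableSet_le_sigma hP n)).aemeasurable]
        exact tsum_congr fun n => lintegral_indicator_one (measurableSet_le_sigma hP n)
    _ = _ := tsum_congr fun n => by
        rw [← map_restrict_le_sigma K ξ hP,
          Measure.map_apply (measurable_pi_apply n) MeasurableSet.univ, Set.preimage_univ,
          Measure.restrict_apply_univ]

lemma tsum_iterate_killedStep_ne_top {P : Set S} (hP : MeasurableSet P)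
    (hσ : meanSigma K P ξ < ∞) : ∑' n, (killedStep K P)^[n] ξ Set.univ ≠ ∞ := by
  rw [← lintegral_sigma_add_one K ξ hP, lintegral_add_right _ measurable_const]
  exact ENNReal.add_ne_top.2 ⟨hσ.ne, by simp⟩

lemma tendsto_iterate_killedStep_univ {P : Set S} (hP : MeasurableSet P)
    (hσ : meanSigma K P ξ < ∞) :
    Tendsto (fun n => (killedStep K P)^[n] ξ Set.univ) atTop (𝓝 0) :=
  ENNReal.tendsto_atTop_zero_of_tsum_ne_top (tsum_iterate_killedStep_ne_top K ξ hP hσ)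

/-! ### The stationary distribution -/

lemma isProbabilityMeasure_stationary {P : Set S} (hP : MeasurableSet P)
    (hσ : meanSigma K P ξ < ∞) : IsProbabilityMeasure (stationary K P ξ) := by
  have hpos : ∑' n, (killedStep K P)^[n] ξ Set.univ ≠ 0 := by
    intro h
    have h0 := ENNReal.tsum_eq_zero.1 h 0
    simp at h0
  refine ⟨?_⟩
  rw [stationary, Measure.smul_apply, smul_eq_mul, lintegral_sigma_add_one K ξ hP,
    flux_eq K ξ hP, Measure.sum_apply _ MeasurableSet.univ]
  exact ENNReal.inv_mul_cancel hpos (tsum_iterate_killedStep_ne_top K ξ hP hσ)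

/-- The occupation measure of a cycle is invariant: one step moves the time-`n` part of the
killed evolution to its time-`(n + 1)` part, and the mass killed on `P`, one in total, restarts
as the time-`0` part `ρ`. -/
lemma step_stationary {P : Set S} (hP : MeasurableSet P) (hK : ∀ x ∈ P, K x = ξ)
    (hσ : meanSigma K P ξ < ∞) : step K (stationary K P ξ) = stationary K P ξ := by
  have hone : ∑' n, (killedStep K P)^[n] ξ P = 1 := by
    refine tendsto_nhds_unique (ENNReal.tendsto_nat_tsum fun n => (killedStep K P)^[n] ξ P) ?_
    have h := ENNReal.Tendsto.sub (tendsto_const_nhds (x := (1 : ℝ≥0∞)))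
      (tendsto_iterate_killedStep_univ K ξ hP hσ) (.inl ENNReal.one_ne_top)
    rw [tsub_zero] at h
    refine h.congr fun n => ?_
    have hsum := sum_iterate_killedStep_add (K := K) hP ξ n
    rw [measure_univ (μ := ξ)] at hsum
    refine ENNReal.sub_eq_of_eq_add ?_ hsum.symm
    exact ne_top_of_le_ne_top ENNReal.one_ne_top (hsum ▸ le_add_self)
  rw [stationary, step_smul, flux_eq K ξ hP, step_sum]
  congr 1
  refine Measure.ext fun A hA => ?_
  rw [Measure.sum_apply _ hA, Measure.sum_apply _ hA,
    tsum_eq_zero_add' (f := fun n => (killedStep K P)^[n] ξ A) ENNReal.summable]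
  simp only [step_eq_killedStep_add hP hK, Measure.add_apply, Measure.smul_apply, smul_eq_mul,
    Function.iterate_succ_apply', Function.iterate_zero, id_eq]
  rw [ENNReal.tsum_add, ENNReal.tsum_mul_right, hone, one_mul, add_comm]

/-! ### Geometric ergodicity -/

/-- A strong Feller chain on a compact space that reaches `P` in finite mean time from every
starting law, restarts from `P` with a fixed law, and has aperiodic cycles is geometrically
ergodic. -/
theorem geometricallyErgodic_of_restart [TopologicalSpace S] [CompactSpace S] {P : Set S}
    (hP : MeasurableSet P) (hK : ∀ x ∈ P, K x = ξ)
    (hσ : ∀ (ζ : Measure S) [IsProbabilityMeasure ζ], meanSigma K P ζ < ∞)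
    (hSF : StrongFeller K) (hap : Aperiodic K P ξ) :
    GeometricallyErgodic K (stationary K P ξ) := by
  simp only [Aperiodic, chainLaw_sigma_eq K ξ hP] at hap
  obtain ⟨N, hN⟩ := exists_survival_le_half hP hSF fun x =>
    tendsto_iterate_killedStep_univ K (K x) hP (hσ (K x))
  obtain ⟨n₀, hn₀⟩ := exists_smul_le_iterate_step hP hK hap
  obtain ⟨m, hm0, ε, hε, hε1, hm⟩ := exists_minorization hP hK hN hn₀
  have := isProbabilityMeasure_stationary K ξ hP (hσ ξ)
  obtain ⟨κ, hκ0, hκ1, c, hc⟩ :=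
    exists_tvDist_iterate_step_le hm0 hε hε1 hm (step_stationary K ξ hP hK (hσ ξ))
  refine ⟨κ, hκ0, hκ1, c, fun n => iSup_le fun x => ?_⟩
  rw [distAt_eq]
  exact hc n x

end PathSpace
end Milestoning

open Milestoning in
theorem theorem4p3 {Ω W : Type*} [TopologicalSpace Ω] [MeasurableSpace Ω] [BorelSpace Ω]
    [StandardBorelSpace Ω] [MeasurableSpace W] (D : Dynamics Ω W)
    (ρ : Measure D.M) [IsProbabilityMeasure ρ] (hρ : ρ D.RM = 1)
    (K : Kernel D.M D.M) [IsMarkovKernel K] (hK : D.IsJumpKernel ρ K)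
    (hσ : ∀ (ξ : Measure D.M) [IsProbabilityMeasure ξ], meanSigma K D.PM ξ < ∞)
    (hM : IsCompact D.M) (hSF : StrongFeller K) (hap : Aperiodic K D.PM ρ) :
    GeometricallyErgodic K (stationary K D.PM ρ) := by
  have : CompactSpace D.M := isCompact_iff_compactSpace.1 hM
  have hP : MeasurableSet D.PM :=
    measurable_subtype_coe (D.isClosed_of_mem D.P D.P_mem).measurableSet
  have hrestart : ∀ x ∈ D.PM, K x = ρ := fun x hx => Measure.ext fun A hA => by
    rw [hK x A hA, Dynamics.jumpProb, if_pos hx]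
  exact geometricallyErgodic_of_restart K ρ hP hrestart hσ hSF hap
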